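/- Let $R$ be an associative unital ring and let $\mathrm{Mod}\text{-}R$ be the category of right $R$-modules. For a class $\mathscr{T}$ of modules, let $\mathrm{Fac}(\mathscr{T})$ be the class of all epimorphic images of modules in $\mathscr{T}$, and write $\mathrm{Fac}(T)$ for the class of epimorphic images of a single module $T$. A right $\mathscr{T}$-approximation of $A$ is a morphism $X\to A$ with $X\in\mathscr{T}$ through which every morphism $X'\to A$ with $X'\in\mathscr{T}$ factors; a left $\mathscr{T}$-approximation of $A$ is a morphism $A\to X$ with $X\in\mathscr{T}$ through which every morphism $A\to X'$ with $X'\in\mathscr{T}$ factors. A full subcategory $\mathscr{T}$ of $\mathrm{Mod}\text{-}R$ that is additive (it contains a zero object and a direct sum of any two of its objects) is called a support $\tau$-tilting subcategory if (i) every module has a right $\mathscr{T}$-approximation; (ii) $\mathrm{Ext}^1_R(T_1,X)=0$ for all $T_1,T_2\in\mathscr{T}$ and all $X\in\mathrm{Fac}(T_2)$; (iii) for every projective module $P$ there is an exact sequence $P\xrightarrow{f}T^0\to T^1\to 0$ with $T^0,T^1\in\mathscr{T}$ and $f$ a left $\mathscr{T}$-approximation of $P$. Two support $\tau$-tilting subcategories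 $\mathscr{T},\mathscr{T}'$ are equivalent if $\mathrm{Fac}(\mathscr{T})=\mathrm{Fac}(\mathscr{T}')$. For a module $T$, let $\mathrm{Add}(T)$ be the class of all modules isomorphic to a direct summand of a (possibly infinite) direct sum of copies of $T$, let $\mathrm{Gen}(T)=\mathrm{Fac}(\mathrm{Add}(T))$, and let $\mathrm{Pres}(T)$ be the class of all modules $X$ admitting an exact sequence $M_1\to M_0\to X\to 0$ with $M_0,M_1\in\mathrm{Add}(T)$. The module $T$ is quasitilting if $\mathrm{Pres}(T)=\mathrm{Gen}(T)$ and $T$ is Ext-projective in $\mathrm{Gen}(T)$, i.e. $\mathrm{Ext}^1_R(T,X)=0$ for all $X\in\mathrm{Gen}(T)$; it is finendo if it is finitely generated as a module over $\mathrm{End}_R(T)$. Two finendo quasitilting modules $T,T'$ are equivalent if $\mathrm{Add}(T)=\mathrm{Add}(T')$. Theorem. For every finendo quasitilting $R$-module $T$, $\mathrm{Add}(T)$ is a support $\tau$-tilting subcategory of $\mathrm{Mod}\text{-}R$, and the assignment $T\mapsto\mathrm{Add}(T)$ induces a well-defined bijection from the set of equivalence classes of finendo quasitilting $R$-modules to the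 set of equivalence classes of support $\tau$-tilting subcategories of $\mathrm{Mod}\text{-}R$. -/

import Mathlib

open CategoryTheory CategoryTheory.Limits

universe u v w

namespace TauTilting

section Abelian

variable {C : Type w} [Category.{v} C] [Abelian C]

/-- A full subcategory (given by its class of objects `P`) is additive if it contains a zero object
and, for any two of its objects, a direct sum of them. -/
structure IsAdditiveSubcategory (P : ObjectProperty C) : Prop where
  exists_zero : ∃ Z : C, P Z ∧ IsZero Z
  exists_biprod : ∀ X Y : C, P X → P Y → ∃ B : C, P B ∧ Nonempty (B ≅ X ⊞ Y)

/-- `f : X ⟶ A` is a right `P`-approximation of `A`. -/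
def IsRightApproximation (P : ObjectProperty C) {X A : C} (f : X ⟶ A) : Prop :=
  P X ∧ ∀ (X' : C), P X' → ∀ g : X' ⟶ A, ∃ h : X' ⟶ X, h ≫ f = g

/-- `f : A ⟶ X` is a left `P`-approximation of `A`. -/
def IsLeftApproximation (P : ObjectProperty C) {A X : C} (f : A ⟶ X) : Prop :=
  P X ∧ ∀ (X' : C), P X' → ∀ g : A ⟶ X', ∃ h : X ⟶ X', f ≫ h = g

/-- Every object admits a right `P`-approximation. -/
def IsContravariantlyFinite (P : ObjectProperty C) : Prop :=
  ∀ A : C, ∃ (X : C) (f : X ⟶ A), IsRightApproximation P f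

/-- `Fac P`: the class of all factor objects of objects in `P`. -/
def Fac (P : ObjectProperty C) : ObjectProperty C :=
  fun X => ∃ (T : C) (p : T ⟶ X), P T ∧ Epi p

/-- Support `τ`-tilting subcategories of an abelian category. -/
structure IsSupportTauTilting [HasExt.{v} C] (P : ObjectProperty C) : Prop where
  additive : IsAdditiveSubcategory P
  contravariantlyFinite : IsContravariantlyFinite P
  /-- `Ext¹(T₁, Fac T₂) = 0` for all `T₁, T₂` in `P`. -/
  ext_eq_zero : ∀ T₁ T₂ : C, P T₁ → P T₂ →
    ∀ (X : C) (p : T₂ ⟶ X), Epi p → ∀ x : Abelian.Ext.{v} T₁ X 1, x = 0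
  /-- Every projective `Q` has an exact sequence `Q ⟶ T⁰ ⟶ T¹ ⟶ 0` with `T⁰, T¹` in `P` whose
  first map is a left `P`-approximation. -/
  exists_exact : ∀ Q : C, Projective Q →
    ∃ (T₀ T₁ : C) (f : Q ⟶ T₀) (g : T₀ ⟶ T₁) (zero : f ≫ g = 0),
      P T₀ ∧ P T₁ ∧ IsLeftApproximation P f ∧ (ShortComplex.mk f g zero).Exact ∧ Epi g

variable (C) in
/-- The support `τ`-tilting subcategories of `C`. -/
def SupportTauTilting [HasExt.{v} C] : Type w :=
  { P : ObjectProperty C // IsSupportTauTilting P }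

/-- Two support `τ`-tilting subcategories are equivalent if they have the same `Fac`. -/
instance supportTauTiltingSetoid [HasExt.{v} C] : Setoid (SupportTauTilting C) where
  r P P' := Fac P.1 = Fac P'.1
  iseqv := ⟨fun _ => rfl, fun h => h.symm, fun h h' => h.trans h'⟩

end Abelian

section Modules

variable {S : Type u} [Ring S]

/-- `AddClass T`: all modules isomorphic to a direct summand of a direct sum `T^(J)` of copies of `T`. -/
def AddClass (T : ModuleCat.{u} S) : ObjectProperty (ModuleCat.{u} S) :=
  fun X => ∃ (J : Type u) (Y : ModuleCat.{u} S), Nonempty ((X × Y) ≃ₗ[S] (J →₀ T))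

/-- `Gen T`: all epimorphic images of modules in `AddClass T`. -/
def Gen (T : ModuleCat.{u} S) : ObjectProperty (ModuleCat.{u} S) :=
  Fac (AddClass T)

/-- `Pres T`: all modules `X` with an exact sequence `M₁ ⟶ M₀ ⟶ X ⟶ 0`, where `M₀, M₁` are in
`AddClass T`. -/
def Pres (T : ModuleCat.{u} S) : ObjectProperty (ModuleCat.{u} S) :=
  fun X => ∃ (M₁ M₀ : ModuleCat.{u} S) (f : M₁ ⟶ M₀) (g : M₀ ⟶ X) (zero : f ≫ g = 0),
    AddClass T M₁ ∧ AddClass T M₀ ∧ (ShortComplex.mk f g zero).Exact ∧ Epi g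

/-- `T` is Ext-projective in the class `P`. -/
def IsExtProjective (P : ObjectProperty (ModuleCat.{u} S)) (T : ModuleCat.{u} S) : Prop :=
  P T ∧ ∀ X : ModuleCat.{u} S, P X → ∀ x : Abelian.Ext.{u} T X 1, x = 0

/-- Quasitilting modules. -/
structure IsQuasitilting (T : ModuleCat.{u} S) : Prop where
  pres_eq_gen : Pres T = Gen T
  extProjective : IsExtProjective (Gen T) T

/-- `T` is finitely generated over its endomorphism ring. -/
def IsFinendo (T : ModuleCat.{u} S) : Prop :=
  Module.Finite (Module.End S T) T

variable (S) in
/-- The finendo quasitilting `S`-modules. -/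
def FinendoQuasitilting : Type (u + 1) :=
  { T : ModuleCat.{u} S // IsFinendo T ∧ IsQuasitilting T }

/-- Two finendo quasitilting modules are equivalent if they have the same `AddClass`. -/
instance finendoQuasitiltingSetoid : Setoid (FinendoQuasitilting S) where
  r T T' := AddClass T.1 = AddClass T'.1
  iseqv := ⟨fun _ => rfl, fun h => h.symm, fun h h' => h.trans h'⟩

end Modules

end TauTilting

/-! Both kinds of object are governed by the class `Gen T` or `Fac P`. For quasitilting `T`,
`Add(T)` is exactly the class of Ext-projectives of `Gen T` (`IsQuasitilting.addClass_iff`), so `Gen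
T` determines `Add(T)`: this gives injectivity. Finendo supplies left `Add(T)`-approximations of
projectives, and their cokernels are Ext-projective in `Gen T`, hence in `Add(T)`. For surjectivity,
take the sequence `S → T₀ → T₁ → 0` of condition (iii) for the regular module and put `T = T₀ ⊕ T₁`.
Every element of a module in `Fac P` is the image of `f 1` under a map from `T₀`, so `T` is cyclic
over its endomorphism ring and `Gen T = Fac P`. Vanishing of `Ext¹` out of `T₁` then yields `Pres T
= Gen T`. -/

namespace TauTilting

/-! ### Vanishing of Ext¹ as extending and lifting of maps -/

section ExtVanishing

variable {S : Type u} [Ring S]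

/-- `Ext¹(N, X) = 0`. -/
def ExtVanish (N X : ModuleCat.{u} S) : Prop :=
  ∀ x : Abelian.Ext.{u} N X 1, x = 0

theorem ExtVanish.exists_extension {M N X : ModuleCat.{u} S} (h : ExtVanish N X)
    {g : M →ₗ[S] N} (hg : Function.Surjective g) (a : LinearMap.ker g →ₗ[S] X) :
    ∃ b : M →ₗ[S] X, ∀ k : LinearMap.ker g, b k = a k := by
  obtain ⟨y, hy⟩ := Abelian.Ext.contravariant_sequence_exact₁
    (LinearMap.shortExact_shortComplexKer hg) X
    (Abelian.Ext.mk₀ (ModuleCat.ofHom a)) (add_zero 1) (h _)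
  obtain ⟨b, rfl⟩ := (Abelian.Ext.mk₀_bijective _ _).surjective y
  rw [Abelian.Ext.mk₀_comp_mk₀] at hy
  have hba := (Abelian.Ext.mk₀_bijective _ _).injective hy
  exact ⟨b.hom, fun k => LinearMap.congr_fun (congrArg ModuleCat.Hom.hom hba) k⟩

/-- A class in `Ext¹(N, X)` dies in `Ext¹(M, X)`, so it is the connecting image of a map on the
kernel; maps that extend to `M` have zero connecting image. -/
theorem ExtVanish.of_extension {M N X : ModuleCat.{u} S} (h : ExtVanish M X)
    {g : M →ₗ[S] N} (hg : Function.Surjective g)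
    (H : ∀ a : LinearMap.ker g →ₗ[S] X, ∃ b : M →ₗ[S] X, ∀ k : LinearMap.ker g, b k = a k) :
    ExtVanish N X := by
  intro x
  have hS := LinearMap.shortExact_shortComplexKer hg
  obtain ⟨y, rfl⟩ := Abelian.Ext.contravariant_sequence_exact₃ hS X x (h _) (add_zero 1)
  obtain ⟨a, rfl⟩ := (Abelian.Ext.mk₀_bijective _ _).surjective y
  obtain ⟨b, hb⟩ := H a.hom
  have hab : a = ModuleCat.ofHom (LinearMap.ker g).subtype ≫ ModuleCat.ofHom b := by
    ext k; exact (hb k).symm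
  subst hab
  rw [← Abelian.Ext.mk₀_comp_mk₀]
  have hzero : hS.extClass.comp
      (Abelian.Ext.mk₀ (ModuleCat.ofHom (LinearMap.ker g).subtype)) (add_zero 1) = 0 :=
    hS.extClass_comp
  rw [← Abelian.Ext.comp_assoc_of_second_deg_zero, hzero, Abelian.Ext.zero_comp]

theorem ExtVanish.exists_lift {T Z X : ModuleCat.{u} S} {g : Z →ₗ[S] X}
    (hg : Function.Surjective g) (h : ExtVanish T (ModuleCat.of S (LinearMap.ker g)))
    (φ : T →ₗ[S] X) : ∃ ψ : T →ₗ[S] Z, g ∘ₗ ψ = φ := by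
  obtain ⟨y, hy⟩ := Abelian.Ext.covariant_sequence_exact₃ T
    (LinearMap.shortExact_shortComplexKer hg)
    (Abelian.Ext.mk₀ (ModuleCat.ofHom φ)) (zero_add 1) (h _)
  obtain ⟨b, rfl⟩ := (Abelian.Ext.mk₀_bijective _ _).surjective y
  rw [Abelian.Ext.mk₀_comp_mk₀] at hy
  exact ⟨b.hom, congrArg ModuleCat.Hom.hom ((Abelian.Ext.mk₀_bijective _ _).injective hy)⟩

theorem ExtVanish.ker_of_lift {T Z X : ModuleCat.{u} S} (h : ExtVanish T Z) {g : Z →ₗ[S] X}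
    (hg : Function.Surjective g) (H : ∀ φ : T →ₗ[S] X, ∃ ψ : T →ₗ[S] Z, g ∘ₗ ψ = φ) :
    ExtVanish T (ModuleCat.of S (LinearMap.ker g)) := by
  intro x
  have hS := LinearMap.shortExact_shortComplexKer hg
  obtain ⟨y, rfl⟩ := Abelian.Ext.covariant_sequence_exact₁ T hS x (h _) (zero_add 1)
  obtain ⟨a, rfl⟩ := (Abelian.Ext.mk₀_bijective _ _).surjective y
  obtain ⟨b, hb⟩ := H a.hom
  have hab : a = ModuleCat.ofHom b ≫ ModuleCat.ofHom g := by
    ext t; exact (LinearMap.congr_fun hb t).symm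
  subst hab
  rw [← Abelian.Ext.mk₀_comp_mk₀, Abelian.Ext.comp_assoc_of_second_deg_zero]
  have : (Abelian.Ext.mk₀ (ModuleCat.ofHom g)).comp hS.extClass (zero_add 1) = 0 :=
    hS.comp_extClass
  rw [this, Abelian.Ext.comp_zero]

theorem ExtVanish.of_retract {M N X : ModuleCat.{u} S} (h : ExtVanish M X)
    (i : N →ₗ[S] M) (p : M →ₗ[S] N) (hip : p ∘ₗ i = LinearMap.id) : ExtVanish N X := by
  intro x
  have hid : ModuleCat.ofHom i ≫ ModuleCat.ofHom p = 𝟙 N := by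
    ext t; exact LinearMap.congr_fun hip t
  rw [← Abelian.Ext.mk₀_id_comp x, ← hid, ← Abelian.Ext.mk₀_comp_mk₀_assoc,
    h ((Abelian.Ext.mk₀ (ModuleCat.ofHom p)).comp x (zero_add 1)), Abelian.Ext.comp_zero]

/-- A free cover of `T`, taken `J` times, covers the sum; its kernel is the sum of the kernels, so
maps extend one summand at a time. -/
theorem ExtVanish.finsupp {T X : ModuleCat.{u} S} (h : ExtVanish T X) (J : Type u) :
    ExtVanish (ModuleCat.of S (J →₀ T)) X := by
  classical
  let g : (T →₀ S) →ₗ[S] T := Finsupp.linearCombination S id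
  have hg : Function.Surjective g := Finsupp.linearCombination_id_surjective S T
  let G : (J →₀ T →₀ S) →ₗ[S] (J →₀ T) := Finsupp.mapRange.linearMap g
  have hG : Function.Surjective G := Finsupp.mapRange_surjective _ (map_zero g) hg
  have : Projective (ModuleCat.of S (J →₀ T →₀ S)) :=
    ModuleCat.projective_of_categoryTheory_projective _
  refine ExtVanish.of_extension (M := ModuleCat.of S (J →₀ T →₀ S))
    (fun x => Abelian.Ext.eq_zero_of_projective x) (g := G) hG fun a => ?_
  let ι (j : J) : LinearMap.ker g →ₗ[S] LinearMap.ker G :=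
    ((Finsupp.lsingle j).comp (LinearMap.ker g).subtype).codRestrict _ fun k => by
      simp [G, Finsupp.mapRange_single]
  choose b hb using fun j =>
    h.exists_extension (M := ModuleCat.of S (T →₀ S)) (g := g) hg (a ∘ₗ ι j)
  refine ⟨Finsupp.lsum ℕ b, fun k => ?_⟩
  have hk (j : J) : (k : J →₀ T →₀ S) j ∈ LinearMap.ker g :=
    DFunLike.congr_fun (LinearMap.mem_ker.1 k.2) j
  have hsum : k = ∑ j ∈ (k : J →₀ T →₀ S).support, ι j ⟨_, hk j⟩ := by
    ext1
    rw [AddSubmonoidClass.coe_finsetSum]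
    exact (Finsupp.sum_single _).symm
  conv_rhs => rw [hsum, map_sum]
  rw [Finsupp.lsum_apply, Finsupp.sum]
  exact Finset.sum_congr rfl fun j _ => hb j ⟨_, hk j⟩

end ExtVanishing

/-! ### Add, Gen and Pres -/

section Classes

variable {S : Type u} [Ring S] {T X Y : ModuleCat.{u} S}

theorem addClass_iff_retract : AddClass T X ↔ ∃ (J : Type u) (i : X →ₗ[S] (J →₀ T))
    (p : (J →₀ T) →ₗ[S] X), p ∘ₗ i = LinearMap.id := by
  constructor
  · rintro ⟨J, Y, ⟨e⟩⟩
    exact ⟨J, e.toLinearMap ∘ₗ LinearMap.inl S X Y, LinearMap.fst S X Y ∘ₗ e.symm.toLinearMap,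
      by ext x; simp⟩
  · rintro ⟨J, i, p, hip⟩
    have h (x : X) : p (i x) = x := LinearMap.congr_fun hip x
    refine ⟨J, ModuleCat.of S (LinearMap.ker p), ⟨LinearEquiv.ofLinearMap
      (i.coprod (LinearMap.ker p).subtype)
      (p.prod ((LinearMap.id - i ∘ₗ p).codRestrict _ fun z => by simp [h])) ?_ ?_⟩⟩
    · ext; simp
    · refine LinearMap.ext fun x => ?_
      obtain ⟨x, y, hy⟩ := x
      rw [LinearMap.mem_ker] at hy
      ext <;> simp [h, hy]

theorem AddClass.of_retract (hX : AddClass T X) (i : Y →ₗ[S] X) (p : X →ₗ[S] Y)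
    (hip : p ∘ₗ i = LinearMap.id) : AddClass T Y := by
  obtain ⟨J, i', p', h⟩ := addClass_iff_retract.1 hX
  refine addClass_iff_retract.2 ⟨J, i' ∘ₗ i, p ∘ₗ p', ?_⟩
  ext y
  have h1 : p' (i' (i y)) = i y := LinearMap.congr_fun h (i y)
  have h2 : p (i y) = y := LinearMap.congr_fun hip y
  simp [h1, h2]

theorem addClass_finsupp (T : ModuleCat.{u} S) (J : Type u) :
    AddClass T (ModuleCat.of S (J →₀ T)) :=
  addClass_iff_retract.2 ⟨J, LinearMap.id, LinearMap.id, rfl⟩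

theorem addClass_self (T : ModuleCat.{u} S) : AddClass T T :=
  (addClass_finsupp T PUnit).of_retract (Finsupp.lsingle PUnit.unit) (Finsupp.lapply PUnit.unit)
    (by ext; simp)

theorem AddClass.trans (hX : AddClass T X) (hY : AddClass X Y) : AddClass T Y := by
  obtain ⟨I, i, p, h⟩ := addClass_iff_retract.1 hX
  obtain ⟨J, i', p', h'⟩ := addClass_iff_retract.1 hY
  let e : (J × I →₀ T) ≃ₗ[S] (J →₀ I →₀ T) := Finsupp.curryLinearEquiv S
  refine addClass_iff_retract.2 ⟨J × I,
    e.symm.toLinearMap ∘ₗ Finsupp.mapRange.linearMap i ∘ₗ i',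
    p' ∘ₗ Finsupp.mapRange.linearMap p ∘ₗ e.toLinearMap, ?_⟩
  have hm (z : J →₀ X) :
      Finsupp.mapRange.linearMap p (Finsupp.mapRange.linearMap i z) = z := by
    rw [← LinearMap.comp_apply, ← Finsupp.mapRange.linearMap_comp, h,
      Finsupp.mapRange.linearMap_id, LinearMap.id_apply]
  ext y
  simp only [LinearMap.comp_apply, LinearEquiv.coe_coe, LinearEquiv.apply_symm_apply, hm]
  exact LinearMap.congr_fun h' y

theorem ExtVanish.of_addClass {N : ModuleCat.{u} S} (h : ExtVanish T X) (hN : AddClass T N) :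
    ExtVanish N X := by
  obtain ⟨J, i, p, hip⟩ := addClass_iff_retract.1 hN
  exact (h.finsupp J).of_retract i p hip

theorem Fac.of_surjective {P : ObjectProperty (ModuleCat.{u} S)} (hX : Fac P X)
    (f : X →ₗ[S] Y) (hf : Function.Surjective f) : Fac P Y := by
  obtain ⟨Z, p, hZ, hp⟩ := hX
  have : Epi (ModuleCat.ofHom f) := (ModuleCat.epi_iff_surjective _).2 hf
  exact ⟨Z, p ≫ ModuleCat.ofHom f, hZ, epi_comp _ _⟩

theorem Fac.of_mem {P : ObjectProperty (ModuleCat.{u} S)} (hX : P X) : Fac P X :=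
  ⟨X, 𝟙 X, hX, inferInstance⟩

/-- The canonical map from copies of `T` indexed by all maps `T → X` to `X`. -/
noncomputable def evalMap (T X : ModuleCat.{u} S) : ((T →ₗ[S] X) →₀ T) →ₗ[S] X :=
  Finsupp.lsum ℕ id

theorem evalMap_comp_lsingle (φ : T →ₗ[S] X) :
    evalMap T X ∘ₗ Finsupp.lsingle φ = φ := by
  ext t; simp [evalMap]

/-- This makes `evalMap T X` a right `Add(T)`-approximation of `X`. -/
theorem exists_evalMap_comp_eq {N : ModuleCat.{u} S} (hN : AddClass T N) (φ : N →ₗ[S] X) :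
    ∃ ψ : N →ₗ[S] ((T →ₗ[S] X) →₀ T), evalMap T X ∘ₗ ψ = φ := by
  obtain ⟨J, i, p, hip⟩ := addClass_iff_retract.1 hN
  refine ⟨Finsupp.lsum ℕ (fun j => Finsupp.lsingle (φ ∘ₗ p ∘ₗ Finsupp.lsingle j)) ∘ₗ i, ?_⟩
  have : evalMap T X ∘ₗ Finsupp.lsum ℕ
      (fun j => Finsupp.lsingle (φ ∘ₗ p ∘ₗ Finsupp.lsingle j)) = φ ∘ₗ p := by
    ext j t
    simp [evalMap]
  rw [← LinearMap.comp_assoc, this, LinearMap.comp_assoc, hip, LinearMap.comp_id]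

theorem gen_iff_evalMap_surjective : Gen T X ↔ Function.Surjective (evalMap T X) := by
  constructor
  · rintro ⟨N, p, hN, hp⟩ x
    obtain ⟨ψ, hψ⟩ := exists_evalMap_comp_eq hN p.hom
    obtain ⟨n, rfl⟩ := (ModuleCat.epi_iff_surjective p).1 hp x
    exact ⟨ψ n, LinearMap.congr_fun hψ n⟩
  · intro h
    exact (Fac.of_mem (addClass_finsupp T _)).of_surjective _ h

theorem gen_of_forall_mem_range (h : ∀ x : X, ∃ (φ : T →ₗ[S] X) (t : T), φ t = x) : Gen T X := by
  refine gen_iff_evalMap_surjective.2 fun x => ?_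
  obtain ⟨φ, t, rfl⟩ := h x
  exact ⟨Finsupp.single φ t, LinearMap.congr_fun (evalMap_comp_lsingle φ) t⟩

theorem pres_le_gen (hX : Pres T X) : Gen T X := by
  obtain ⟨_, M₀, _, g, _, _, hM₀, _, hg⟩ := hX
  exact ⟨M₀, g, hM₀, hg⟩

theorem pres_of_gen_ker {M : ModuleCat.{u} S} (hM : AddClass T M) (g : M →ₗ[S] X)
    (hg : Function.Surjective g) (hK : Gen T (ModuleCat.of S (LinearMap.ker g))) :
    Pres T X := by
  obtain ⟨N, p, hN, hp⟩ := hK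
  have hS := LinearMap.shortExact_shortComplexKer hg
  refine ⟨N, M, p ≫ ModuleCat.ofHom (LinearMap.ker g).subtype, ModuleCat.ofHom g, ?_, hN, hM, ?_,
    hS.epi_g⟩
  · rw [Category.assoc]
    exact (congrArg (p ≫ ·) (LinearMap.shortComplexKer g).zero).trans comp_zero
  · refine ModuleCat.shortComplex_exact _ fun m => ⟨fun hm => ?_, ?_⟩
    · obtain ⟨n, hn⟩ := (ModuleCat.epi_iff_surjective p).1 hp ⟨m, hm⟩
      exact ⟨n, congrArg Subtype.val hn⟩
    · rintro ⟨n, rfl⟩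
      exact (p n).2

theorem IsQuasitilting.addClass_iff (hT : IsQuasitilting T) :
    AddClass T X ↔ IsExtProjective (Gen T) X := by
  constructor
  · exact fun hX => ⟨Fac.of_mem hX, fun Y hY =>
      ExtVanish.of_addClass (hT.extProjective.2 Y hY) hX⟩
  · rintro ⟨hX, hext⟩
    rw [← hT.pres_eq_gen] at hX
    obtain ⟨M₁, M₀, f, g, zero, hM₁, hM₀, hex, hg⟩ := hX
    -- The kernel is an image of `M₁`, so Ext-projectivity of `X` splits `g`.
    have hK : Gen T (ModuleCat.of S (LinearMap.ker g.hom)) :=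
      (Fac.of_mem hM₁).of_surjective
        (f.hom.codRestrict _ fun m => (ShortComplex.mk f g zero).moduleCat_zero_apply m)
        fun k => by
          obtain ⟨m, hm⟩ := (ShortComplex.moduleCat_exact_iff _).1 hex k.1 k.2
          exact ⟨m, Subtype.ext hm⟩
    obtain ⟨s, hs⟩ := ExtVanish.exists_lift ((ModuleCat.epi_iff_surjective g).1 hg) (hext _ hK)
      LinearMap.id
    exact hM₀.of_retract s g.hom hs

end Classes

/-! ### From finendo quasitilting modules to support τ-tilting subcategories -/

section Approximation

variable {S : Type u} [Ring S]

/-- If every map from `Q` to a module in `Gen T` factors through `f : Q → T₀`, and `T` is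
Ext-projective in `Gen T`, then so is the cokernel of `f`. -/
theorem extProjective_cokernel {T Q T₀ : ModuleCat.{u} S} (hT : IsExtProjective (Gen T) T)
    (hT₀ : AddClass T T₀) (f : Q →ₗ[S] T₀)
    (hf : ∀ X, Gen T X → ∀ a : Q →ₗ[S] X, ∃ b : T₀ →ₗ[S] X, b ∘ₗ f = a) :
    IsExtProjective (Gen T) (ModuleCat.of S (T₀ ⧸ LinearMap.range f)) := by
  refine ⟨(Fac.of_mem hT₀).of_surjective _ (Submodule.mkQ_surjective _), fun X hX => ?_⟩
  refine ExtVanish.of_extension (ExtVanish.of_addClass (hT.2 X hX) hT₀)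
    (Submodule.mkQ_surjective (LinearMap.range f)) fun a => ?_
  let f' : Q →ₗ[S] LinearMap.ker (LinearMap.range f).mkQ :=
    f.codRestrict _ fun q => by simp
  obtain ⟨b, hb⟩ := hf X hX (a ∘ₗ f')
  refine ⟨b, fun k => ?_⟩
  obtain ⟨q, hq⟩ : k.1 ∈ LinearMap.range f := by simpa using k.2
  have : f' q = k := Subtype.ext hq
  rw [← hq, ← this]
  exact LinearMap.congr_fun hb q

/-- Maps to epimorphic images factor through a left approximation of a projective module. -/
theorem exists_factor_of_fac {P : ObjectProperty (ModuleCat.{u} S)} {Q T₀ X : ModuleCat.{u} S}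
    [Projective Q] {f : Q ⟶ T₀} (hf : IsLeftApproximation P f) (hX : Fac P X)
    (a : Q →ₗ[S] X) : ∃ b : T₀ →ₗ[S] X, b ∘ₗ f.hom = a := by
  obtain ⟨Z, p, hZ, hp⟩ := hX
  obtain ⟨c, hc⟩ := hf.2 Z hZ (Projective.factorThru (ModuleCat.ofHom a) p)
  refine ⟨(c ≫ p).hom, ?_⟩
  rw [← ModuleCat.hom_comp, ← Category.assoc, hc, Projective.factorThru_comp,
    ModuleCat.hom_ofHom]

/-- The finite tuple `v` of `End(T)`-generators reaches every element of `T` under maps `T^s → T`.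
Sending each basis vector of the free cover of `Q` to its own copy of `v` approximates that cover; a
section `σ` restricts this to `Q`. -/
theorem exists_leftApproximation {T : ModuleCat.{u} S} (hT : IsFinendo T) (Q : ModuleCat.{u} S)
    [Projective Q] :
    ∃ (T₀ : ModuleCat.{u} S) (f : Q ⟶ T₀), IsLeftApproximation (AddClass T) f := by
  classical
  obtain ⟨s, hs⟩ := hT.fg_top
  have hgen (t : T) : ∃ b : (s →₀ T) →ₗ[S] T, b (Finsupp.equivFunOnFinite.symm (↑)) = t := by
    have ht : t ∈ Submodule.span (Module.End S T) (s : Set T) := hs ▸ Submodule.mem_top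
    obtain ⟨c, -, hc⟩ := Submodule.mem_span_finset.1 ht
    refine ⟨Finsupp.lsum ℕ fun x => c x, ?_⟩
    rw [Finsupp.lsum_apply, Finsupp.sum_fintype _ _ (by simp), ← hc, ← Finset.sum_coe_sort s]
    simp
  let v : s →₀ T := Finsupp.equivFunOnFinite.symm (↑)
  let T₀ : ModuleCat.{u} S := ModuleCat.of S (Q →₀ s →₀ T)
  have hT₀ : AddClass T T₀ :=
    (addClass_finsupp T s).trans (addClass_finsupp (ModuleCat.of S (s →₀ T)) Q)
  let F : (Q →₀ S) →ₗ[S] (Q →₀ s →₀ T) :=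
    Finsupp.mapRange.linearMap (LinearMap.toSpanSingleton S _ v)
  have : Module.Projective S Q := ModuleCat.projective_of_module_projective Q
  obtain ⟨σ, hσ⟩ := Module.projective_def'.1 this
  -- every element of a direct sum of copies of `T` is an image of `v`
  have hgen' (J : Type u) (z : J →₀ T) : ∃ b : (s →₀ T) →ₗ[S] (J →₀ T), b v = z := by
    choose b hb using hgen
    refine ⟨∑ j ∈ z.support, Finsupp.lsingle j ∘ₗ b (z j), ?_⟩
    rw [LinearMap.sum_apply]
    simp only [LinearMap.comp_apply]
    conv_rhs => rw [← Finsupp.sum_single z]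
    exact Finset.sum_congr rfl fun j _ => congrArg (Finsupp.single j) (hb (z j))
  refine ⟨T₀, ModuleCat.ofHom (F ∘ₗ σ), hT₀, fun X hX g => ?_⟩
  obtain ⟨J, i, p, hip⟩ := addClass_iff_retract.1 hX
  choose b hb using fun q : Q => hgen' J (i (g q))
  refine ⟨ModuleCat.ofHom (p ∘ₗ Finsupp.lsum ℕ b), ?_⟩
  have key : p ∘ₗ Finsupp.lsum ℕ b ∘ₗ F = g.hom ∘ₗ Finsupp.linearCombination S id := by
    ext q
    have h : p (i (g q)) = g q := LinearMap.congr_fun hip (g q)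
    simpa [F, hb] using h
  ext q
  have h : Finsupp.linearCombination S id (σ q) = q := LinearMap.congr_fun hσ q
  exact (LinearMap.congr_fun key (σ q)).trans (congrArg g h)

theorem isAdditiveSubcategory_addClass (T : ModuleCat.{u} S) :
    IsAdditiveSubcategory (AddClass T) where
  exists_zero := ⟨ModuleCat.of S PUnit, (addClass_self T).of_retract 0 0 (Subsingleton.elim _ _),
    ModuleCat.isZero_of_subsingleton _⟩
  exists_biprod X Y hX hY := by
    refine ⟨ModuleCat.of S (X × Y), ?_, ⟨(ModuleCat.biprodIsoProd X Y).symm⟩⟩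
    obtain ⟨I, i, p, hip⟩ := addClass_iff_retract.1 hX
    obtain ⟨J, i', p', hip'⟩ := addClass_iff_retract.1 hY
    refine addClass_iff_retract.2 ⟨I ⊕ J,
      (Finsupp.sumFinsuppLEquivProdFinsupp S).symm.toLinearMap ∘ₗ i.prodMap i',
      p.prodMap p' ∘ₗ (Finsupp.sumFinsuppLEquivProdFinsupp S).toLinearMap, ?_⟩
    refine LinearMap.ext fun x => ?_
    have h1 : p (i x.1) = x.1 := LinearMap.congr_fun hip x.1
    have h2 : p' (i' x.2) = x.2 := LinearMap.congr_fun hip' x.2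
    ext <;> simp [h1, h2]

theorem isSupportTauTilting_addClass {T : ModuleCat.{u} S} (hfin : IsFinendo T)
    (hT : IsQuasitilting T) : IsSupportTauTilting (AddClass T) where
  additive := isAdditiveSubcategory_addClass T
  contravariantlyFinite A := by
    refine ⟨ModuleCat.of S ((T →ₗ[S] A) →₀ T), ModuleCat.ofHom (evalMap T A),
      addClass_finsupp _ _, fun N hN g => ?_⟩
    obtain ⟨ψ, hψ⟩ := exists_evalMap_comp_eq hN g.hom
    exact ⟨ModuleCat.ofHom ψ, ModuleCat.hom_ext hψ⟩
  ext_eq_zero T₁ T₂ h₁ h₂ X p hp :=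
    ExtVanish.of_addClass (hT.extProjective.2 X ⟨T₂, p, h₂, hp⟩) h₁
  exists_exact Q hQ := by
    obtain ⟨T₀, f, hf⟩ := exists_leftApproximation hfin Q
    refine ⟨T₀, ModuleCat.of S (T₀ ⧸ LinearMap.range f.hom), f,
      ModuleCat.ofHom (LinearMap.range f.hom).mkQ, ?_, hf.1, hT.addClass_iff.2 ?_, hf, ?_, ?_⟩
    · ext q; simp
    · exact extProjective_cokernel hT.extProjective hf.1 f.hom
        fun X hX a => exists_factor_of_fac hf hX a
    · exact ShortComplex.Exact.moduleCat_of_range_eq_ker _ _ (Submodule.ker_mkQ _).symm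
    · exact (ModuleCat.epi_iff_surjective _).2 (Submodule.mkQ_surjective _)

end Approximation

/-! ### From support τ-tilting subcategories to finendo quasitilting modules -/

section Reconstruction

variable {S : Type u} [Ring S] {P : ObjectProperty (ModuleCat.{u} S)}

/-- `P` need not contain infinite direct sums, but `evalMap T X` factors through a right
`P`-approximation of `X`, which is therefore onto. -/
theorem IsContravariantlyFinite.fac_of_gen (hP : IsContravariantlyFinite P)
    {T X : ModuleCat.{u} S} (hT : P T) (hX : Gen T X) : Fac P X := by
  obtain ⟨Z, p, hZ, hp⟩ := hP X
  refine ⟨Z, p, hZ, (ModuleCat.epi_iff_surjective _).2 fun x => ?_⟩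
  choose h hh using fun φ : T →ₗ[S] X => hp T hT (ModuleCat.ofHom φ)
  obtain ⟨z, rfl⟩ := gen_iff_evalMap_surjective.1 hX x
  refine ⟨Finsupp.lsum ℕ (fun φ => (h φ).hom) z, ?_⟩
  have : p.hom ∘ₗ Finsupp.lsum ℕ (fun φ => (h φ).hom) = evalMap T X := by
    ext φ t
    have := congrArg (fun k => k.hom t) (hh φ)
    simpa [evalMap] using this
  exact LinearMap.congr_fun this z

theorem IsSupportTauTilting.exists_finendo_quasitilting (hP : IsSupportTauTilting P) :
    ∃ T : ModuleCat.{u} S, IsFinendo T ∧ IsQuasitilting T ∧ Gen T = Fac P := by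
  have hproj : Projective (ModuleCat.of S S) := ModuleCat.projective_of_categoryTheory_projective _
  obtain ⟨T₀, T₁, f, g, zero, hT₀, hT₁, hf, hex, hg⟩ := hP.exists_exact (ModuleCat.of S S) hproj
  obtain ⟨T, hT, ⟨e⟩⟩ := hP.additive.exists_biprod T₀ T₁ hT₀ hT₁
  let i : T₀ →ₗ[S] T := (biprod.inl ≫ e.inv).hom
  let p : T →ₗ[S] T₀ := (e.hom ≫ biprod.fst).hom
  let i' : T₁ →ₗ[S] T := (biprod.inr ≫ e.inv).hom
  let p' : T →ₗ[S] T₁ := (e.hom ≫ biprod.snd).hom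
  have hip : p ∘ₗ i = LinearMap.id := by
    simp only [p, i, ← ModuleCat.hom_comp]; simp
  have hip' : p' ∘ₗ i' = LinearMap.id := by
    simp only [p', i', ← ModuleCat.hom_comp]; simp
  have hpi : p (i (f.hom 1)) = f.hom 1 := LinearMap.congr_fun hip _
  have hgsurj : Function.Surjective g.hom := (ModuleCat.epi_iff_surjective g).1 hg
  -- every element of a module in `Fac P` is an image of `f 1`
  have hfac {X : ModuleCat.{u} S} (hX : Fac P X) (x : X) : ∃ b : T₀ →ₗ[S] X, b (f.hom 1) = x := by
    obtain ⟨b, hb⟩ := exists_factor_of_fac hf hX (LinearMap.toSpanSingleton S X x)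
    exact ⟨b, by simpa using LinearMap.congr_fun hb 1⟩
  have hgen : Gen T = Fac P := by
    ext X
    refine ⟨fun hX => hP.contravariantlyFinite.fac_of_gen hT hX, fun hX => ?_⟩
    refine gen_of_forall_mem_range fun x => ?_
    obtain ⟨b, hb⟩ := hfac hX x
    exact ⟨b ∘ₗ p, i (f.hom 1), (congrArg b hpi).trans hb⟩
  have hext {N X : ModuleCat.{u} S} (hN : P N) (hX : Gen T X) : ExtVanish N X := by
    rw [hgen] at hX
    obtain ⟨Z, q, hZ, hq⟩ := hX
    exact hP.ext_eq_zero N Z hN hZ X q hq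
  refine ⟨T, ⟨⟨{i (f.hom 1)}, ?_⟩⟩, ⟨?_, ?_, fun X hX => hext hT hX⟩, hgen⟩
  · rw [Finset.coe_singleton, eq_top_iff]
    intro t _
    obtain ⟨b, hb⟩ := hfac (Fac.of_mem hT) t
    exact Submodule.mem_span_singleton.2 ⟨b ∘ₗ p, (congrArg b hpi).trans hb⟩
  · ext X
    refine ⟨pres_le_gen, fun hX => ?_⟩
    have hsurj := gen_iff_evalMap_surjective.1 hX
    have hZ : Gen T (ModuleCat.of S ((T →ₗ[S] X) →₀ T)) := Fac.of_mem (addClass_finsupp T _)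
    refine pres_of_gen_ker (addClass_finsupp T _) (evalMap T X) hsurj ?_
    have hTK : ExtVanish T (ModuleCat.of S (LinearMap.ker (evalMap T X))) :=
      ExtVanish.ker_of_lift (Z := ModuleCat.of S ((T →ₗ[S] X) →₀ T)) (hext hT hZ) hsurj
        fun φ => ⟨_, evalMap_comp_lsingle φ⟩
    have hT₁K := hTK.of_retract i' p' hip'
    refine gen_of_forall_mem_range fun k => ?_
    -- The map `c` sends `f 1` to `k`, but lands only in the direct sum. On `ker g = range f` it
    -- takes values in the multiples of `k`, hence in the kernel of `evalMap T X`; as `Ext¹` of `T₁`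
    -- into that kernel vanishes, this restriction extends to `T₀`, and the extension still sends `f
    -- 1` to `k`.
    obtain ⟨c, hc⟩ := hfac (hgen ▸ hZ) k.1
    have hcf (s : S) : c (f.hom s) = s • k.1 := by
      rw [← hc, ← map_smul, ← map_smul, smul_eq_mul, mul_one]
    have hck (l : LinearMap.ker g.hom) : c l ∈ LinearMap.ker (evalMap T X) := by
      obtain ⟨s, hs⟩ := (ShortComplex.moduleCat_exact_iff _).1 hex l.1 l.2
      rw [← hs]
      exact (hcf s).symm ▸ Submodule.smul_mem _ s k.2
    obtain ⟨b, hb⟩ := hT₁K.exists_extension hgsurj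
      ((c ∘ₗ (LinearMap.ker g.hom).subtype).codRestrict _ hck)
    refine ⟨b ∘ₗ p, i (f.hom 1), ?_⟩
    have hbf := hb ⟨f.hom 1, (ShortComplex.mk f g zero).moduleCat_zero_apply 1⟩
    rw [LinearMap.comp_apply, hpi]
    exact hbf.trans (Subtype.ext hc)
  · exact Fac.of_mem (addClass_self T)

end Reconstruction

/-- `T ↦ Add T` on equivalence classes. -/
noncomputable def addClassMap (S : Type u) [Ring S] :
    Quotient (finendoQuasitiltingSetoid (S := S)) →
      Quotient (supportTauTiltingSetoid (C := ModuleCat.{u} S)) :=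
  Quotient.map (fun T => ⟨AddClass T.1, isSupportTauTilting_addClass T.2.1 T.2.2⟩)
    fun _ _ h => congrArg Fac h

theorem addClassMap_bijective (S : Type u) [Ring S] : Function.Bijective (addClassMap S) := by
  constructor
  · rintro ⟨T⟩ ⟨T'⟩ h
    have hgen : Gen T.1 = Gen T'.1 := Quotient.exact h
    refine Quotient.sound (?_ : AddClass T.1 = AddClass T'.1)
    ext X
    rw [T.2.2.addClass_iff, T'.2.2.addClass_iff, hgen]
  · rintro ⟨P⟩
    obtain ⟨T, hfin, hT, hgen⟩ := P.2.exists_finendo_quasitilting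
    exact ⟨Quotient.mk _ ⟨T, hfin, hT⟩, Quotient.sound hgen⟩

end TauTilting

/-- Right `R`-modules are modules over `Rᵐᵒᵖ`. -/
theorem mainTheorem5 (R : Type u) [Ring R] :
    ∃ e : Quotient (TauTilting.finendoQuasitiltingSetoid (S := Rᵐᵒᵖ)) ≃
        Quotient (TauTilting.supportTauTiltingSetoid (C := ModuleCat.{u} Rᵐᵒᵖ)),
      ∀ T : TauTilting.FinendoQuasitilting Rᵐᵒᵖ,
        ∃ h : TauTilting.IsSupportTauTilting (TauTilting.AddClass T.1),
          e (Quotient.mk _ T) = Quotient.mk _ ⟨TauTilting.AddClass T.1, h⟩ :=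
  ⟨Equiv.ofBijective _ (TauTilting.addClassMap_bijective Rᵐᵒᵖ), fun T =>
    ⟨TauTilting.isSupportTauTilting_addClass T.2.1 T.2.2, rfl⟩⟩
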